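/- All graphs are finite and simple. For a graph $G=(V,E)$ and $A\subseteq V$ let $N(A)=\{v\in V: v \text{ has a neighbour in } A\}$ and $d(A)=|A|-|N(A)|$. A critical independent set of $G$ is an independent set $A$ with $d(A)=\max\{d(I): I\subseteq V \text{ independent}\}$; $\ker(G)$ is the intersection of all critical independent sets of $G$, and $\mathrm{core}(G)$ is the intersection of all maximum independent sets of $G$. The graph $G$ is König–Egerváry if $\alpha(G)+\mu(G)=|V|$, where $\alpha(G)$ is the maximum size of an independent set and $\mu(G)$ the maximum size of a matching. The graph $G$ is unicyclic if it is connected and has exactly one cycle $C$; in that case put $N_1(C)=\{x\in V\setminus V(C): x \text{ has a neighbour in } V(C)\}$, and for $x\in N_1(C)$ let $T_x$ be the connected component containing $x$ of the graph $G-xy$, where $y\in V(C)$ is the neighbour of $x$ on $C$ (it is unique, and $T_x$ is a tree). Theorem. If $G$ is a unicyclic graph that is not König–Egerváry, with cycle $C$, then $$\ker(G)=\bigcup\{\ker(T_x): x\in N_1(C)\}=\mathrm{core}(G).$$ -/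

import Mathlib

namespace SimpleGraph

section Critical

variable {V : Type*} (G : SimpleGraph V)

/-- The open neighbourhood `N(A) = {v : N(v) ∩ A ≠ ∅}` of a set `A` of vertices. -/
def setNeighborhood (A : Set V) : Set V :=
  {v | (G.neighborSet v ∩ A).Nonempty}

/-- The difference `d(A) = |A| - |N(A)|` (an integer; used for finite graphs only). -/
noncomputable def difference (A : Set V) : ℤ :=
  (A.ncard : ℤ) - ((G.setNeighborhood A).ncard : ℤ)

/-- A critical independent set: an independent set whose difference is maximum among the
differences of all independent sets. -/
def IsCriticalIndepSet (A : Set V) : Prop :=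
  G.IsIndepSet A ∧ ∀ I : Set V, G.IsIndepSet I → G.difference I ≤ G.difference A

/-- `ker(G)`, the intersection of all critical independent sets. -/
def ker : Set V :=
  ⋂ A ∈ {A : Set V | G.IsCriticalIndepSet A}, A

/-- `core(G)`, the intersection of all maximum independent sets. -/
def core [Finite V] : Set V :=
  ⋂ S ∈ {S : Finset V | G.IsMaximumIndepSet S}, (S : Set V)

/-- The matching number `μ(G)`: the maximum number of edges of a matching (finite graphs). -/
noncomputable def matchingNumber : ℕ :=
  sSup {n | ∃ M : G.Subgraph, M.IsMatching ∧ M.edgeSet.ncard = n}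

/-- A König–Egerváry graph: `α(G) + μ(G) = |V(G)|`. -/
def IsKonigEgervary : Prop :=
  G.indepNum + G.matchingNumber = Nat.card V

end Critical

section Unicyclic

variable {V : Type*} {G : SimpleGraph V}

/-- A subgraph is a cycle of `G` if it consists of the vertices and edges of a closed walk
that is a cycle. -/
def Subgraph.IsCycleOf (C : G.Subgraph) : Prop :=
  ∃ (u : V) (p : G.Walk u u), p.IsCycle ∧ p.toSubgraph = C

variable (G)

/-- A unicyclic graph: connected, with a unique cycle (as a subgraph). -/
def IsUnicyclic : Prop :=
  G.Connected ∧ ∃! C : G.Subgraph, C.IsCycleOf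

variable {G}

/-- `N₁(C)`: the vertices outside `C` that have a neighbour on `C`. -/
def Subgraph.firstNeighborhood (C : G.Subgraph) : Set V :=
  {v | v ∉ C.verts ∧ (G.neighborSet v ∩ C.verts).Nonempty}

variable (G)

/-- The connected component of `G - xy` that contains `x`. -/
abbrev branchComponent (x y : V) : (G.deleteEdges {s(x, y)}).ConnectedComponent :=
  (G.deleteEdges {s(x, y)}).connectedComponentMk x

/-- The component of `G - xy` containing `x`, as a graph on its own vertex set. For a unicyclic
graph with cycle `C`, `x ∈ N₁(C)` and `y` the neighbour of `x` on `C`, this is the tree `T_x`. -/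
abbrev branch (x y : V) : SimpleGraph (G.branchComponent x y) :=
  (G.branchComponent x y).toSimpleGraph

/-- The union of the sets `ker(T_x)`, `x ∈ N₁(C)`, as a set of vertices of `G`. The edge `xy`
joining `x` to `C` enters through its endpoint `y`. -/
def unionKerBranches (C : G.Subgraph) : Set V :=
  ⋃ x ∈ C.firstNeighborhood, ⋃ y ∈ {y | y ∈ C.verts ∧ G.Adj x y},
    Subtype.val '' (G.branch x y).ker

end Unicyclic

end SimpleGraph

/-! All three sets equal the core of the forest $F=G-V(C)$. Two general facts are used. In a
bipartite graph, König's theorem matches the complement of a maximum independent set $S$ into $S$;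
this bounds every difference, and it follows that ker and core agree
(`IsBipartiteOn.mem_coreOn_iff`). Moreover, the core of a graph restricts to unions of components
(`mem_coreOn_iff_of_subset`). Since $F$ is the disjoint union of the trees $T_x$, its core is the
union of the $\ker(T_x)$.

The failure of the König–Egerváry property enters once, in `notMem_coreOn`: if $x$ lay in every
maximum independent set of $T_x$, a matching in $G-y$ could be completed by the edge $yx$. Hence
some maximum independent set of $F$ has no neighbour on $C$, and $\alpha(G)=\alpha(F)+\alpha(C)$.
Rotating sets along $C$ removes cycle vertices from the core (`core_eq`). For the kernel, the cycle
part of a set never raises its difference (`ker_eq`). -/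

namespace SimpleGraph

/-! ### Independence, differences and matchings relative to a vertex subset -/

section RelativeIndependence

variable {V : Type*} {G : SimpleGraph V}

lemma isIndepSet_iff_forall_not_adj {S : Set V} :
    G.IsIndepSet S ↔ ∀ u ∈ S, ∀ v ∈ S, ¬ G.Adj u v :=
  ⟨fun h _ hu _ hv huv => h hu hv huv.ne huv, fun h u hu v hv _ => h u hu v hv⟩

lemma IsIndepSet.not_adj {S : Set V} (h : G.IsIndepSet S) {u v : V} (hu : u ∈ S) (hv : v ∈ S) :
    ¬ G.Adj u v :=
  isIndepSet_iff_forall_not_adj.1 h u hu v hv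

lemma IsIndepSet.subset {S T : Set V} (h : G.IsIndepSet S) (hT : T ⊆ S) : G.IsIndepSet T :=
  Set.Pairwise.mono hT h

lemma IsIndepSet.union {S T : Set V} (hS : G.IsIndepSet S) (hT : G.IsIndepSet T)
    (h : ∀ u ∈ S, ∀ v ∈ T, ¬ G.Adj u v) : G.IsIndepSet (S ∪ T) := by
  rw [isIndepSet_iff_forall_not_adj]
  rintro u (hu | hu) v (hv | hv) huv
  · exact hS.not_adj hu hv huv
  · exact h u hu v hv huv
  · exact h v hv u hu huv.symm
  · exact hT.not_adj hu hv huv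

lemma mem_setNeighborhood {A : Set V} {v : V} :
    v ∈ G.setNeighborhood A ↔ ∃ u ∈ A, G.Adj v u := by
  simp only [setNeighborhood, Set.Nonempty, Set.mem_inter_iff, mem_neighborSet, Set.mem_ofPred_eq]
  exact ⟨fun ⟨u, h, h'⟩ => ⟨u, h', h⟩, fun ⟨u, h, h'⟩ => ⟨u, h', h⟩⟩

variable (G)

/-- `S` is a maximum independent set of the subgraph induced by `A`. -/
structure IsMaxIndepOn (A S : Set V) : Prop where
  subset : S ⊆ A
  indep : G.IsIndepSet S
  le : ∀ I ⊆ A, G.IsIndepSet I → I.ncard ≤ S.ncard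

/-- The difference of `I` in the subgraph induced by `A`. -/
noncomputable def diffOn (A I : Set V) : ℤ :=
  (I.ncard : ℤ) - ((G.setNeighborhood I ∩ A).ncard : ℤ)

/-- `S` is a critical independent set of the subgraph induced by `A`. -/
structure IsCriticalOn (A S : Set V) : Prop where
  subset : S ⊆ A
  indep : G.IsIndepSet S
  le : ∀ I ⊆ A, G.IsIndepSet I → G.diffOn A I ≤ G.diffOn A S

/-- The set of vertices of `A` lying in all maximum independent sets of the subgraph induced
by `A`. -/
def coreOn (A : Set V) : Set V := {v | v ∈ A ∧ ∀ S, G.IsMaxIndepOn A S → v ∈ S}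

/-- The subgraph induced by `A` is bipartite. -/
def IsBipartiteOn (A : Set V) : Prop :=
  ∃ c : V → Bool, ∀ u ∈ A, ∀ v ∈ A, G.Adj u v → c u ≠ c v

/-- `f` matches `B` into `S`. -/
structure MatchesInto (B S : Set V) (f : V → V) : Prop where
  injOn : Set.InjOn f B
  mapsTo : Set.MapsTo f B S
  adj : ∀ v ∈ B, G.Adj v (f v)

variable {G}

lemma IsBipartiteOn.mono {A B : Set V} (h : G.IsBipartiteOn A) (hB : B ⊆ A) :
    G.IsBipartiteOn B := by
  obtain ⟨c, hc⟩ := h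
  exact ⟨c, fun u hu v hv => hc u (hB hu) v (hB hv)⟩

lemma setNeighborhood_union (I J : Set V) :
    G.setNeighborhood (I ∪ J) = G.setNeighborhood I ∪ G.setNeighborhood J := by
  ext v
  simp only [mem_setNeighborhood, Set.mem_union]
  constructor
  · rintro ⟨u, hu | hu, h⟩
    exacts [Or.inl ⟨u, hu, h⟩, Or.inr ⟨u, hu, h⟩]
  · rintro (⟨u, hu, h⟩ | ⟨u, hu, h⟩)
    exacts [⟨u, Or.inl hu, h⟩, ⟨u, Or.inr hu, h⟩]

lemma IsMaxIndepOn.ncard_eq {A S T : Set V} (hS : G.IsMaxIndepOn A S) (hT : G.IsMaxIndepOn A T) :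
    S.ncard = T.ncard :=
  le_antisymm (hT.le S hS.subset hS.indep) (hS.le T hT.subset hT.indep)

lemma IsMaxIndepOn.of_ncard_le {A S T : Set V} (hS : G.IsMaxIndepOn A S) (hT : T ⊆ A)
    (hT' : G.IsIndepSet T) (h : S.ncard ≤ T.ncard) : G.IsMaxIndepOn A T :=
  ⟨hT, hT', fun I hI hI' => (hS.le I hI hI').trans h⟩

variable [Finite V]

variable (G) in
lemma exists_isMaxIndepOn (A : Set V) : ∃ S, G.IsMaxIndepOn A S := by
  obtain ⟨S, ⟨hSA, hS⟩, hmax⟩ := Set.exists_max_image {I : Set V | I ⊆ A ∧ G.IsIndepSet I}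
    Set.ncard (Set.toFinite _) ⟨∅, Set.empty_subset _, by simp [IsIndepSet]⟩
  exact ⟨S, hSA, hS, fun I hI hI' => hmax I ⟨hI, hI'⟩⟩

/-- Hall's condition for an independent set outside a maximum independent set. -/
lemma IsMaxIndepOn.ncard_le_ncard_neighborhood {A S B : Set V} (hS : G.IsMaxIndepOn A S)
    (hB : B ⊆ A \ S) (hBi : G.IsIndepSet B) :
    B.ncard ≤ (G.setNeighborhood B ∩ S).ncard := by
  -- Exchange: replacing the neighbours of `B` in `S` by `B` cannot enlarge `S`.
  have h1 : G.IsIndepSet ((S \ G.setNeighborhood B) ∪ B) := by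
    refine (hS.indep.subset Set.sdiff_subset).union hBi ?_
    rintro u ⟨_, hu⟩ v hv huv
    exact hu (mem_setNeighborhood.2 ⟨v, hv, huv⟩)
  have h2 := hS.le _ (Set.union_subset (Set.sdiff_subset.trans hS.subset)
    (hB.trans Set.sdiff_subset)) h1
  rw [Set.ncard_union_eq (Set.disjoint_left.2 fun u hu hu' => (hB hu').2 hu.1)] at h2
  have h3 := Set.ncard_inter_add_ncard_sdiff_eq_ncard S (G.setNeighborhood B)
  rw [Set.inter_comm] at h3
  omega

/-- König's theorem: outside a maximum independent set of a bipartite graph there is a matching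
of all vertices into that set. -/
lemma IsMaxIndepOn.exists_matchesInto {A S : Set V} (hS : G.IsMaxIndepOn A S)
    (hA : G.IsBipartiteOn A) : ∃ f, G.MatchesInto (A \ S) S f := by
  classical
  have := Fintype.ofFinite V
  obtain ⟨c, hc⟩ := hA
  let t : ↥(A \ S) → Finset V := fun v => (G.neighborSet v ∩ S).toFinset
  have hall : ∀ s : Finset ↥(A \ S), s.card ≤ (s.biUnion t).card := by
    intro s
    -- Hall's condition is known for independent sets only, so `s` is split into colour classes;
    -- their neighbourhoods in `S` have opposite colours, hence are disjoint.
    let B : Bool → Set V := fun b => {v | ∃ h : v ∈ A \ S, ⟨v, h⟩ ∈ s ∧ c v = b}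
    have hBsub : ∀ b, B b ⊆ A \ S := fun b v hv => hv.1
    have hBi : ∀ b, G.IsIndepSet (B b) := fun b => isIndepSet_iff_forall_not_adj.2 <| by
      rintro u ⟨hu, _, hub⟩ v ⟨hv, _, hvb⟩ huv
      exact hc u hu.1 v hv.1 huv (hub.trans hvb.symm)
    have hle := fun b => hS.ncard_le_ncard_neighborhood (hBsub b) (hBi b)
    have hcard : s.card = (B true).ncard + (B false).ncard := by
      rw [← Set.ncard_union_eq, ← Set.ncard_coe_finset,
        ← Set.ncard_image_of_injective (s : Set ↥(A \ S)) Subtype.val_injective]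
      · congr 1
        ext v
        simp only [Set.mem_image, SetLike.mem_coe, Subtype.exists, exists_and_right,
          exists_eq_right, Set.mem_union]
        constructor
        · rintro ⟨h, hs⟩
          cases hcv : c v
          · exact Or.inr ⟨h, hs, hcv⟩
          · exact Or.inl ⟨h, hs, hcv⟩
        · rintro (⟨h, hs, _⟩ | ⟨h, hs, _⟩) <;> exact ⟨h, hs⟩
      · refine Set.disjoint_left.2 ?_
        rintro v ⟨_, _, h1⟩ ⟨_, _, h2⟩
        simp [h1] at h2
    have hdisj : Disjoint (G.setNeighborhood (B true) ∩ S) (G.setNeighborhood (B false) ∩ S) := by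
      refine Set.disjoint_left.2 ?_
      rintro v ⟨hv, hvS⟩ ⟨hv', _⟩
      obtain ⟨u, ⟨hu, _, hub⟩, huv⟩ := mem_setNeighborhood.1 hv
      obtain ⟨w, ⟨hw, _, hwb⟩, hwv⟩ := mem_setNeighborhood.1 hv'
      have h1 := hc _ (hS.subset hvS) _ hu.1 huv
      have h2 := hc _ (hS.subset hvS) _ hw.1 hwv
      rw [hub] at h1
      rw [hwb] at h2
      cases h : c v <;> simp_all
    have hsub : (G.setNeighborhood (B true) ∩ S) ∪ (G.setNeighborhood (B false) ∩ S) ⊆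
        (s.biUnion t : Finset V) := by
      rintro v (⟨hv, hvS⟩ | ⟨hv, hvS⟩) <;>
      · obtain ⟨u, ⟨hu, hus, _⟩, huv⟩ := mem_setNeighborhood.1 hv
        simp only [Finset.coe_biUnion, Set.mem_iUnion]
        exact ⟨⟨u, hu⟩, hus, by simpa [t] using ⟨huv.symm, hvS⟩⟩
    have h := Set.ncard_le_ncard hsub
    rw [Set.ncard_union_eq hdisj, Set.ncard_coe_finset] at h
    have := hle true
    have := hle false
    omega
  obtain ⟨g, hg, hgt⟩ := (Finset.all_card_le_biUnion_card_iff_exists_injective t).1 hall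
  have hgt' : ∀ v : ↥(A \ S), G.Adj v (g v) ∧ g v ∈ S := fun v => by simpa [t] using hgt v
  refine ⟨fun v => if h : v ∈ A \ S then g ⟨v, h⟩ else v, ?_, ?_, ?_⟩
  · intro u hu v hv huv
    simp only [hu, hv, dif_pos] at huv
    simpa using hg huv
  · intro v hv
    simp only [hv, dif_pos]
    exact (hgt' _).2
  · intro v hv
    simp only [hv, dif_pos]
    exact (hgt' ⟨v, hv⟩).1

/-- A matching of `A \ S` into the independent set `S` bounds all differences in `A`. -/
lemma MatchesInto.diffOn_le {A S I : Set V} {f : V → V} (hf : G.MatchesInto (A \ S) S f)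
    (hS : S ⊆ A) (hI : I ⊆ A) : G.diffOn A I ≤ (I ∩ (S \ f '' (A \ S))).ncard := by
  -- The partners of `I \ S` lie in `S` and the partners of matched vertices of `I ∩ S` lie outside
  -- `S`. Together they pay for all of `I` except its unmatched vertices.
  have h1 : f '' (I \ S) ∪ ((A \ S) ∩ f ⁻¹' I) ⊆ G.setNeighborhood I ∩ A := by
    rintro v (⟨u, hu, rfl⟩ | ⟨hv, hvI⟩)
    · exact ⟨mem_setNeighborhood.2 ⟨u, hu.1, (hf.adj u ⟨hI hu.1, hu.2⟩).symm⟩,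
        hS (hf.mapsTo ⟨hI hu.1, hu.2⟩)⟩
    · exact ⟨mem_setNeighborhood.2 ⟨f v, hvI, hf.adj v hv⟩, hv.1⟩
  have hsub : I \ S ⊆ A \ S := Set.sdiff_subset_sdiff_left hI
  have h2 : Disjoint (f '' (I \ S)) ((A \ S) ∩ f ⁻¹' I) := by
    refine Set.disjoint_left.2 ?_
    rintro v ⟨u, hu, rfl⟩ ⟨hv, _⟩
    exact hv.2 (hf.mapsTo (hsub hu))
  have h3 := Set.ncard_le_ncard h1
  rw [Set.ncard_union_eq h2, Set.InjOn.ncard_image (hf.injOn.mono hsub)] at h3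
  have h4 : I ∩ S = (I ∩ (S \ f '' (A \ S))) ∪ f '' ((A \ S) ∩ f ⁻¹' I) := by
    ext v
    constructor
    · rintro ⟨hvI, hvS⟩
      by_cases h : v ∈ f '' (A \ S)
      · obtain ⟨u, hu, rfl⟩ := h
        exact Or.inr ⟨u, ⟨hu, hvI⟩, rfl⟩
      · exact Or.inl ⟨hvI, hvS, h⟩
    · rintro (⟨hvI, hvS, _⟩ | ⟨u, ⟨hu, huI⟩, rfl⟩)
      · exact ⟨hvI, hvS⟩
      · exact ⟨huI, hf.mapsTo hu⟩
  have h5 := Set.ncard_union_le (I ∩ (S \ f '' (A \ S))) (f '' ((A \ S) ∩ f ⁻¹' I))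
  rw [← h4, Set.InjOn.ncard_image (hf.injOn.mono Set.inter_subset_left)] at h5
  have h6 := Set.ncard_inter_add_ncard_sdiff_eq_ncard I S
  rw [diffOn]
  omega

lemma MatchesInto.ncard_unmatched_le {A S : Set V} {f : V → V} (hf : G.MatchesInto (A \ S) S f)
    (hS : G.IsIndepSet S) : ((S \ f '' (A \ S)).ncard : ℤ) ≤ G.diffOn A S := by
  have h1 : G.setNeighborhood S ∩ A ⊆ A \ S := by
    rintro v ⟨hv, hvA⟩
    obtain ⟨u, hu, huv⟩ := mem_setNeighborhood.1 hv
    exact ⟨hvA, fun h => hS.not_adj h hu huv⟩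
  have h2 := Set.ncard_le_ncard h1
  have h3 := Set.ncard_sdiff_add_ncard_of_subset hf.mapsTo.image_subset
  rw [hf.injOn.ncard_image] at h3
  rw [diffOn]
  omega

/-- `I` need not be independent; this is what allows the bound to be applied to a union of two
critical sets. -/
lemma MatchesInto.diffOn_le_diffOn {A S I : Set V} {f : V → V} (hf : G.MatchesInto (A \ S) S f)
    (hSA : S ⊆ A) (hS : G.IsIndepSet S) (hI : I ⊆ A) : G.diffOn A I ≤ G.diffOn A S := by
  have h1 := hf.diffOn_le hSA hI
  have h2 := hf.ncard_unmatched_le hS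
  have h3 := Set.ncard_le_ncard (Set.inter_subset_right : I ∩ (S \ f '' (A \ S)) ⊆ _)
  omega

/-- The difference of `I` is at most the number of unmatched vertices in `I`, and at least that of
`S`, hence at least the number of all unmatched vertices. -/
lemma MatchesInto.unmatched_subset {A S I : Set V} {f : V → V} (hf : G.MatchesInto (A \ S) S f)
    (hSA : S ⊆ A) (hS : G.IsIndepSet S) (hI : G.IsCriticalOn A I) :
    S \ f '' (A \ S) ⊆ I := by
  have h1 := hf.diffOn_le hSA hI.subset
  have h2 := hf.ncard_unmatched_le hS
  have h3 := hI.le S hSA hS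
  have h4 := Set.eq_of_subset_of_ncard_le (Set.inter_subset_right : I ∩ (S \ f '' (A \ S)) ⊆ _)
    (by omega)
  exact h4 ▸ Set.inter_subset_left

lemma IsMaxIndepOn.isCriticalOn {A S : Set V} (hS : G.IsMaxIndepOn A S)
    (hA : G.IsBipartiteOn A) : G.IsCriticalOn A S := by
  obtain ⟨f, hf⟩ := hS.exists_matchesInto hA
  exact ⟨hS.subset, hS.indep, fun I hI _ => hf.diffOn_le_diffOn hS.subset hS.indep hI⟩

lemma IsMaxIndepOn.sdiff_singleton {A S : Set V} {v : V} (hS : G.IsMaxIndepOn A S)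
    (hv : v ∈ G.coreOn A) : G.IsMaxIndepOn (A \ {v}) (S \ {v}) := by
  refine ⟨Set.sdiff_subset_sdiff_left hS.subset, hS.indep.subset Set.sdiff_subset, ?_⟩
  intro I hI hIi
  -- A larger `I` would be a maximum independent set of `A` that misses `v`.
  by_contra! h
  have h1 := Set.ncard_sdiff_singleton_add_one (hv.2 S hS)
  have h2 := hv.2 I (hS.of_ncard_le (hI.trans Set.sdiff_subset) hIi (by omega))
  exact (hI h2).2 rfl

/-- König's theorem in `A \ {v}`: a core vertex can be left unmatched. -/
lemma IsMaxIndepOn.exists_matchesInto_sdiff_singleton {A S : Set V} (hS : G.IsMaxIndepOn A S)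
    (hA : G.IsBipartiteOn A) {v : V} (hv : v ∈ G.coreOn A) :
    ∃ f, G.MatchesInto (A \ S) (S \ {v}) f := by
  have hvS := hv.2 S hS
  have hset : (A \ {v}) \ (S \ {v}) = A \ S := by
    ext u
    simp only [Set.mem_sdiff, Set.mem_singleton_iff]
    constructor
    · rintro ⟨⟨h1, h2⟩, h3⟩
      exact ⟨h1, fun h => h3 ⟨h, h2⟩⟩
    · rintro ⟨h1, h2⟩
      exact ⟨⟨h1, fun h => h2 (h ▸ hvS)⟩, fun h => h2 h.1⟩
  exact hset ▸ (hS.sdiff_singleton hv).exists_matchesInto (hA.mono Set.sdiff_subset)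

/-- In a bipartite graph, a vertex lies in all critical independent sets if and only if it lies
in all maximum independent sets. -/
lemma IsBipartiteOn.mem_coreOn_iff {A : Set V} (hA : G.IsBipartiteOn A) {v : V} :
    v ∈ G.coreOn A ↔ v ∈ A ∧ ∀ I, G.IsCriticalOn A I → v ∈ I := by
  refine ⟨fun hv => ⟨hv.1, fun I hI => ?_⟩, fun ⟨hv, h⟩ => ⟨hv, fun S hS => h S (hS.isCriticalOn hA)⟩⟩
  obtain ⟨S, hS⟩ := G.exists_isMaxIndepOn A
  have hvS := hv.2 S hS
  obtain ⟨f, hf⟩ := hS.exists_matchesInto_sdiff_singleton hA hv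
  have hf' : G.MatchesInto (A \ S) S f :=
    ⟨hf.injOn, fun u hu => (hf.mapsTo hu).1, hf.adj⟩
  refine hf'.unmatched_subset hS.subset hS.indep hI ⟨hvS, ?_⟩
  rintro ⟨u, hu, h⟩
  exact (hf.mapsTo hu).2 h

-- Supermodularity of the difference, since $N(I\cap J)\subseteq N(I)\cap N(J)$.
variable (G) in
lemma diffOn_add_diffOn_le (A I J : Set V) :
    G.diffOn A I + G.diffOn A J ≤ G.diffOn A (I ∪ J) + G.diffOn A (I ∩ J) := by
  have h1 := Set.ncard_union_add_ncard_inter I J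
  have h2 := Set.ncard_union_add_ncard_inter (G.setNeighborhood I ∩ A) (G.setNeighborhood J ∩ A)
  rw [← Set.union_inter_distrib_right, ← setNeighborhood_union] at h2
  have h3 : G.setNeighborhood (I ∩ J) ∩ A ⊆
      (G.setNeighborhood I ∩ A) ∩ (G.setNeighborhood J ∩ A) := by
    rintro v ⟨hv, hvA⟩
    obtain ⟨u, hu, h⟩ := mem_setNeighborhood.1 hv
    exact ⟨⟨mem_setNeighborhood.2 ⟨u, hu.1, h⟩, hvA⟩, mem_setNeighborhood.2 ⟨u, hu.2, h⟩, hvA⟩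
  have h4 := Set.ncard_le_ncard h3
  simp only [diffOn]
  omega

lemma IsBipartiteOn.isCriticalOn_inter {A I J : Set V} (hA : G.IsBipartiteOn A)
    (hI : G.IsCriticalOn A I) (hJ : G.IsCriticalOn A J) : G.IsCriticalOn A (I ∩ J) := by
  obtain ⟨S, hS⟩ := G.exists_isMaxIndepOn A
  obtain ⟨f, hf⟩ := hS.exists_matchesInto hA
  have h1 := G.diffOn_add_diffOn_le A I J
  have h2 := hf.diffOn_le_diffOn hS.subset hS.indep (Set.union_subset hI.subset hJ.subset)
  have h3 := hI.le S hS.subset hS.indep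
  refine ⟨Set.inter_subset_left.trans hI.subset, hI.indep.subset Set.inter_subset_left,
    fun K hK hK' => ?_⟩
  have h4 := hJ.le K hK hK'
  omega

/-- Maximum independent sets restrict to unions of components. -/
lemma IsMaxIndepOn.inter {A T S : Set V} (hS : G.IsMaxIndepOn A S) (hTA : T ⊆ A)
    (hT : ∀ u ∈ T, ∀ v ∈ A \ T, ¬ G.Adj u v) : G.IsMaxIndepOn T (S ∩ T) := by
  refine ⟨Set.inter_subset_right, hS.indep.subset Set.inter_subset_left, fun I hI hIi => ?_⟩
  have h1 : G.IsIndepSet (I ∪ (S \ T)) :=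
    hIi.union (hS.indep.subset Set.sdiff_subset)
      fun u hu v hv => hT u (hI hu) v ⟨hS.subset hv.1, hv.2⟩
  have h2 := hS.le _ (Set.union_subset (hI.trans hTA) (Set.sdiff_subset.trans hS.subset)) h1
  rw [Set.ncard_union_eq (Set.disjoint_left.2 fun u hu hu' => hu'.2 (hI hu))] at h2
  have h3 := Set.ncard_inter_add_ncard_sdiff_eq_ncard S T
  omega

/-- On a union of components, a maximum independent set may be exchanged for another one. -/
lemma IsMaxIndepOn.exchange {A T S W : Set V} (hS : G.IsMaxIndepOn A S) (hTA : T ⊆ A)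
    (hT : ∀ u ∈ T, ∀ v ∈ A \ T, ¬ G.Adj u v) (hW : G.IsMaxIndepOn T W) :
    G.IsMaxIndepOn A (W ∪ (S \ T)) := by
  refine hS.of_ncard_le (Set.union_subset (hW.subset.trans hTA)
    (Set.sdiff_subset.trans hS.subset)) (hW.indep.union (hS.indep.subset Set.sdiff_subset)
      fun u hu v hv => hT u (hW.subset hu) v ⟨hS.subset hv.1, hv.2⟩) ?_
  rw [Set.ncard_union_eq (Set.disjoint_left.2 fun u hu hu' => hu'.2 (hW.subset hu)),
    ← (hS.inter hTA hT).ncard_eq hW, Set.ncard_inter_add_ncard_sdiff_eq_ncard]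

lemma mem_coreOn_iff_of_subset {A T : Set V} (hTA : T ⊆ A)
    (hT : ∀ u ∈ T, ∀ v ∈ A \ T, ¬ G.Adj u v) {v : V} (hv : v ∈ T) :
    v ∈ G.coreOn A ↔ v ∈ G.coreOn T := by
  constructor
  · intro h
    refine ⟨hv, fun W hW => ?_⟩
    obtain ⟨S, hS⟩ := G.exists_isMaxIndepOn A
    exact (h.2 _ (hS.exchange hTA hT hW)).resolve_right fun h' => h'.2 hv
  · intro h
    exact ⟨hTA hv, fun S hS => (h.2 _ (hS.inter hTA hT)).1⟩

lemma IsMaxIndepOn.union_compl {B S J : Set V} (hS : G.IsMaxIndepOn Bᶜ S)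
    (hJ : G.IsMaxIndepOn B J) (h : ∀ u ∈ S, ∀ v ∈ J, ¬ G.Adj u v) :
    G.IsMaxIndepOn Set.univ (S ∪ J) := by
  refine ⟨Set.subset_univ _, hS.indep.union hJ.indep h, fun I _ hI => ?_⟩
  rw [Set.ncard_union_eq (Set.disjoint_left.2 fun u hu hu' => hS.subset hu (hJ.subset hu')),
    ← Set.ncard_inter_add_ncard_sdiff_eq_ncard I B]
  have h1 := hJ.le (I ∩ B) Set.inter_subset_right (hI.subset Set.inter_subset_left)
  have h2 := hS.le (I \ B) (fun u hu => hu.2) (hI.subset Set.sdiff_subset)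
  omega

/-- The independence numbers of the two sides add up, so `I` must attain both. -/
lemma IsMaxIndepOn.sdiff_of_union_compl {B S J I : Set V} (hS : G.IsMaxIndepOn Bᶜ S)
    (hJ : G.IsMaxIndepOn B J) (h : ∀ u ∈ S, ∀ v ∈ J, ¬ G.Adj u v)
    (hI : G.IsMaxIndepOn Set.univ I) : G.IsMaxIndepOn Bᶜ (I \ B) := by
  refine hS.of_ncard_le (fun u hu => hu.2) (hI.indep.subset Set.sdiff_subset) ?_
  have h1 := hI.le _ (Set.subset_univ _) (hS.indep.union hJ.indep h)
  rw [Set.ncard_union_eq (Set.disjoint_left.2 fun u hu hu' => hS.subset hu (hJ.subset hu')),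
    ← Set.ncard_inter_add_ncard_sdiff_eq_ncard I B] at h1
  have h2 := hJ.le (I ∩ B) Set.inter_subset_right (hI.indep.subset Set.inter_subset_left)
  omega

end RelativeIndependence

/-! ### A matching criterion for the König–Egerváry property -/

section KonigEgervary

variable {V : Type*} {G : SimpleGraph V}

/-- The subgraph formed by the edges `s(v, f v)`, where `f` matches `Sᶜ` into `S`. -/
def MatchesInto.toSubgraph {S : Set V} {f : V → V} (hf : G.MatchesInto Sᶜ S f) : G.Subgraph where
  verts := Sᶜ ∪ f '' Sᶜ
  Adj u v := (u ∈ Sᶜ ∧ v = f u) ∨ (v ∈ Sᶜ ∧ u = f v)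
  adj_sub := by
    rintro u v (⟨h, rfl⟩ | ⟨h, rfl⟩)
    exacts [hf.adj u h, (hf.adj v h).symm]
  edge_vert := by
    rintro u v (⟨h, rfl⟩ | ⟨h, rfl⟩)
    exacts [Or.inl h, Or.inr ⟨v, h, rfl⟩]
  symm := ⟨fun _ _ h => h.symm⟩

lemma MatchesInto.isMatching_toSubgraph {S : Set V} {f : V → V} (hf : G.MatchesInto Sᶜ S f) :
    hf.toSubgraph.IsMatching := by
  rintro v (hv | ⟨u, hu, rfl⟩)
  · refine ⟨f v, Or.inl ⟨hv, rfl⟩, ?_⟩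
    rintro w (⟨_, rfl⟩ | ⟨hw, rfl⟩)
    · rfl
    · exact absurd (hf.mapsTo hw) hv
  · refine ⟨u, Or.inr ⟨hu, rfl⟩, ?_⟩
    rintro w (⟨h, _⟩ | ⟨hw, h⟩)
    · exact absurd (hf.mapsTo hu) h
    · exact (hf.injOn hu hw h).symm

variable [Finite V]

/-- Each edge has an endpoint outside `I`, and these endpoints are distinct. -/
lemma Subgraph.IsMatching.ncard_edgeSet_le {M : G.Subgraph} (hM : M.IsMatching) {I : Set V}
    (hI : G.IsIndepSet I) : M.edgeSet.ncard ≤ Iᶜ.ncard := by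
  have h : ∀ e : Sym2 V, ∃ v : V, e ∈ M.edgeSet → v ∉ I ∧ v ∈ e := by
    intro e
    induction e with
    | _ u v =>
      by_cases hu : u ∈ I
      · exact ⟨v, fun he => ⟨fun hv => hI.not_adj hu hv (M.adj_sub he), Sym2.mem_mk_right u v⟩⟩
      · exact ⟨u, fun _ => ⟨hu, Sym2.mem_mk_left u v⟩⟩
  choose g hg using h
  refine Set.ncard_le_ncard_of_injOn g (fun e he => (hg e he).1) ?_
  intro e he e' he' hee'
  have h1 := (hg e he).2
  have h2 := (hg e' he').2
  rw [← hee'] at h2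
  obtain ⟨w, hw⟩ := h1
  obtain ⟨w', hw'⟩ := h2
  rw [hw, Subgraph.mem_edgeSet] at he
  rw [hw', Subgraph.mem_edgeSet] at he'
  rw [hw, hw', (hM he.fst_mem).unique he he']

lemma MatchesInto.ncard_le_ncard_edgeSet {S : Set V} {f : V → V} (hf : G.MatchesInto Sᶜ S f) :
    Sᶜ.ncard ≤ hf.toSubgraph.edgeSet.ncard := by
  refine Set.ncard_le_ncard_of_injOn (fun v => s(v, f v)) (fun v hv => Or.inl ⟨hv, rfl⟩) ?_
  intro u hu v hv huv
  rcases Sym2.eq_iff.1 huv with h | ⟨rfl, _⟩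
  · exact h.1
  · exact absurd (hf.mapsTo hv) hu

/-- A graph with an independent set `S` and a matching of all other vertices into `S` is a
König–Egerváry graph. -/
lemma MatchesInto.isKonigEgervary {S : Set V} {f : V → V} (hf : G.MatchesInto Sᶜ S f)
    (hS : G.IsIndepSet S) : G.IsKonigEgervary := by
  classical
  have := Fintype.ofFinite V
  -- Boundedness is needed because `sSup` of an unbounded set of naturals is `0`.
  have hbdd : BddAbove {n | ∃ M : G.Subgraph, M.IsMatching ∧ M.edgeSet.ncard = n} :=
    ⟨Sᶜ.ncard, by rintro _ ⟨M, hM, rfl⟩; exact hM.ncard_edgeSet_le hS⟩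
  have h1 : Sᶜ.ncard ≤ G.matchingNumber :=
    hf.ncard_le_ncard_edgeSet.trans (le_csSup hbdd ⟨_, hf.isMatching_toSubgraph, rfl⟩)
  have h2 : S.ncard ≤ G.indepNum := by
    rw [Set.ncard_eq_toFinset_card' S]
    exact IsIndepSet.card_le_indepNum (by simpa using hS)
  have h3 : G.matchingNumber ≤ Sᶜ.ncard := by
    refine csSup_le ⟨_, _, hf.isMatching_toSubgraph, rfl⟩ ?_
    rintro _ ⟨M, hM, rfl⟩
    exact hM.ncard_edgeSet_le hS
  obtain ⟨I, hI⟩ := G.exists_isNIndepSet_indepNum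
  have h4 := hf.ncard_le_ncard_edgeSet.trans (hf.isMatching_toSubgraph.ncard_edgeSet_le hI.isIndepSet)
  have h5 := Set.ncard_add_ncard_compl S
  have h6 := Set.ncard_add_ncard_compl (I : Set V)
  rw [Set.ncard_coe_finset, hI.card_eq] at h6
  rw [IsKonigEgervary]
  omega

end KonigEgervary

/-! ### Passing between induced subgraphs and vertex subsets -/

section Transport

variable {V W : Type*} {G : SimpleGraph V} {H : SimpleGraph W}

lemma isIndepSet_image_iff (f : H ↪g G) {J : Set W} :
    G.IsIndepSet (f '' J) ↔ H.IsIndepSet J := by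
  simp only [isIndepSet_iff_forall_not_adj, Set.forall_mem_image, f.map_adj_iff]

lemma diffOn_range_image (f : H ↪g G) (J : Set W) :
    G.diffOn (Set.range f) (f '' J) = H.difference J := by
  have h : G.setNeighborhood (f '' J) ∩ Set.range f = f '' H.setNeighborhood J := by
    ext v
    constructor
    · rintro ⟨hv, w, rfl⟩
      obtain ⟨_, ⟨u, hu, rfl⟩, hwu⟩ := mem_setNeighborhood.1 hv
      exact ⟨w, mem_setNeighborhood.2 ⟨u, hu, f.map_adj_iff.1 hwu⟩, rfl⟩
    · rintro ⟨w, hw, rfl⟩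
      obtain ⟨u, hu, hwu⟩ := mem_setNeighborhood.1 hw
      exact ⟨mem_setNeighborhood.2 ⟨f u, ⟨u, hu, rfl⟩, f.map_adj_iff.2 hwu⟩, w, rfl⟩
  rw [diffOn, difference, h, Set.ncard_image_of_injective _ f.injective,
    Set.ncard_image_of_injective _ f.injective]

lemma isCriticalOn_range_image_iff (f : H ↪g G) {J : Set W} :
    G.IsCriticalOn (Set.range f) (f '' J) ↔ H.IsCriticalIndepSet J := by
  constructor
  · intro h
    refine ⟨(isIndepSet_image_iff f).1 h.indep, fun I hI => ?_⟩
    rw [← diffOn_range_image f, ← diffOn_range_image f]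
    exact h.le _ (Set.image_subset_range f I) ((isIndepSet_image_iff f).2 hI)
  · intro h
    refine ⟨Set.image_subset_range f J, (isIndepSet_image_iff f).2 h.1, fun I hI hI' => ?_⟩
    obtain ⟨I, rfl⟩ := Set.subset_range_iff_exists_image_eq.1 hI
    rw [diffOn_range_image f, diffOn_range_image f]
    exact h.2 I ((isIndepSet_image_iff f).1 hI')

lemma mem_ker {w : W} : w ∈ H.ker ↔ ∀ J, H.IsCriticalIndepSet J → w ∈ J := by
  simp [ker]

/-- The kernel of an induced subgraph in terms of critical sets relative to its vertex set. -/
lemma mem_image_ker_iff (f : H ↪g G) {v : V} :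
    v ∈ f '' H.ker ↔ v ∈ Set.range f ∧ ∀ I, G.IsCriticalOn (Set.range f) I → v ∈ I := by
  constructor
  · rintro ⟨w, hw, rfl⟩
    refine ⟨⟨w, rfl⟩, fun I hI => ?_⟩
    obtain ⟨J, rfl⟩ := Set.subset_range_iff_exists_image_eq.1 hI.subset
    exact ⟨w, mem_ker.1 hw J ((isCriticalOn_range_image_iff f).1 hI), rfl⟩
  · rintro ⟨⟨w, rfl⟩, h⟩
    refine ⟨w, mem_ker.2 fun J hJ => ?_, rfl⟩
    exact (f.injective.mem_set_image).1 (h _ ((isCriticalOn_range_image_iff f).2 hJ))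

lemma mem_ker_iff_univ {v : V} :
    v ∈ G.ker ↔ ∀ I, G.IsCriticalOn Set.univ I → v ∈ I := by
  have h := mem_image_ker_iff (Embedding.refl : G ↪g G) (v := v)
  have hr : Set.range (Embedding.refl : G ↪g G) = Set.univ := Set.range_id
  rw [hr] at h
  simpa using h

lemma coreOn_univ [Finite V] : G.coreOn Set.univ = G.core := by
  classical
  have := Fintype.ofFinite V
  ext v
  simp only [coreOn, core, Set.mem_univ, true_and, Set.mem_iInter, Set.mem_ofPred_eq,
    SetLike.mem_coe]
  constructor
  · intro h S hS
    refine h S ⟨Set.subset_univ _, hS.isIndepSet, fun I _ hI => ?_⟩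
    rw [Set.ncard_coe_finset, Set.ncard_eq_toFinset_card' I]
    exact hS.maximum _ (by simpa using hI)
  · intro h S hS
    have := h S.toFinset ⟨by simpa using hS.indep, fun T hT => ?_⟩
    · simpa using this
    · rw [← Set.ncard_eq_toFinset_card' S, ← Set.ncard_coe_finset]
      exact hS.le _ (Set.subset_univ _) hT

end Transport

/-! ### The cycle and the branches of a unicyclic graph -/

section Structure

variable {V : Type*} {G : SimpleGraph V} {C : G.Subgraph}

lemma Subgraph.IsCycleOf.connected (hC : C.IsCycleOf) : C.Connected := by
  obtain ⟨u, p, _, rfl⟩ := hC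
  exact p.toSubgraph_connected

/-- A cycle has a successor function. -/
lemma Subgraph.IsCycleOf.exists_successor (hC : C.IsCycleOf) :
    ∃ σ : V → V, Set.InjOn σ C.verts ∧ (∀ v ∈ C.verts, C.Adj v (σ v)) ∧
      ∀ u v, C.Adj u v → v = σ u ∨ u = σ v := by
  obtain ⟨u, p, hp, rfl⟩ := hC
  -- Each vertex of the cycle starts exactly one dart and ends exactly one; `σ` follows the darts.
  have hfst : (p.darts.map (·.fst)).Nodup := p.map_fst_darts ▸ hp.nodup_dropLast_support
  have hsnd : (p.darts.map (·.snd)).Nodup := p.map_snd_darts ▸ hp.support_nodup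
  have hd : ∀ v, ∃ w, v ∈ p.toSubgraph.verts → ∃ d ∈ p.darts, d.fst = v ∧ d.snd = w := by
    intro v
    by_cases hv : v ∈ p.toSubgraph.verts
    · have h1 : v ∈ p.support.dropLast := by
        rw [Walk.mem_verts_toSubgraph] at hv
        refine (p.tail_support_perm_dropLast_support).mem_iff.1 ?_
        rcases (Walk.mem_support_iff p).1 hv with rfl | h
        · exact Walk.end_mem_tail_support hp.not_nil
        · exact h
      rw [← p.map_fst_darts, List.mem_map] at h1
      obtain ⟨d, hd, h⟩ := h1
      exact ⟨d.snd, fun _ => ⟨d, hd, h, rfl⟩⟩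
    · exact ⟨v, fun h => absurd h hv⟩
  choose σ hσ using hd
  have huniq : ∀ d ∈ p.darts, d.snd = σ d.fst := by
    intro d hd
    obtain ⟨d', hd', h1, h2⟩ := hσ d.fst
      (p.mem_verts_toSubgraph.2 (p.dart_fst_mem_support_of_mem_darts hd))
    rw [← h2, List.inj_on_of_nodup_map hfst hd' hd h1]
  refine ⟨σ, ?_, ?_, ?_⟩
  · intro v hv w hw hvw
    obtain ⟨d, hd, rfl, h2⟩ := hσ v hv
    obtain ⟨d', hd', rfl, h2'⟩ := hσ w hw
    rw [List.inj_on_of_nodup_map hsnd hd hd' (h2.trans (hvw.trans h2'.symm))]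
  · intro v hv
    obtain ⟨d, hd, rfl, h2⟩ := hσ v hv
    rw [← h2, Walk.adj_toSubgraph_iff_mem_edges]
    exact List.mem_map_of_mem hd
  · intro v w hvw
    rw [Walk.adj_toSubgraph_iff_mem_edges, Walk.edges, List.mem_map] at hvw
    obtain ⟨d, hd, h⟩ := hvw
    have := huniq d hd
    rcases Sym2.eq_iff.1 h with ⟨rfl, rfl⟩ | ⟨rfl, rfl⟩
    · exact Or.inl this
    · exact Or.inr this

lemma Subgraph.Connected.reachable_deleteEdges (hC : C.Connected) {e : Sym2 V}
    (he : e ∉ C.edgeSet) {u v : V} (hu : u ∈ C.verts) (hv : v ∈ C.verts) :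
    (G.deleteEdges {e}).Reachable u v := by
  let f : C.coe →g G.deleteEdges {e} :=
    ⟨Subtype.val, fun {a b} hab => by
      rw [SimpleGraph.deleteEdges_adj]
      exact ⟨C.adj_sub hab, fun h => he (Set.mem_singleton_iff.1 h ▸ hab)⟩⟩
  exact (hC.preconnected ⟨u, hu⟩ ⟨v, hv⟩).map f

/-- Every cycle is `C`, so an edge off `C` lies on no cycle. -/
lemma IsUnicyclic.isBridge (hG : G.IsUnicyclic) (hC : C.IsCycleOf) {e : Sym2 V}
    (he : e ∈ G.edgeSet) (heC : e ∉ C.edgeSet) : G.IsBridge e := by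
  rw [isBridge_iff_forall_cycle_notMem he]
  intro u p hp hep
  rw [hG.2.unique hC ⟨u, p, hp, rfl⟩] at heC
  exact heC (p.mem_edges_toSubgraph.2 hep)

/-- The cycle of a unicyclic graph has no chord. -/
lemma IsUnicyclic.adj_cycle (hG : G.IsUnicyclic) (hC : C.IsCycleOf) {u v : V}
    (hu : u ∈ C.verts) (hv : v ∈ C.verts) (huv : G.Adj u v) : C.Adj u v := by
  by_contra h
  exact isBridge_iff.1 (hG.isBridge hC (e := s(u, v)) huv h)
    (hC.connected.reachable_deleteEdges h hu hv)

lemma IsUnicyclic.isBipartiteOn_compl_singleton (hG : G.IsUnicyclic) (hC : C.IsCycleOf) {y : V}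
    (hy : y ∈ C.verts) : G.IsBipartiteOn {y}ᶜ := by
  have hacyc : (G.deleteIncidenceSet y).IsAcyclic := by
    intro v c hc
    have hle := G.deleteIncidenceSet_le y
    have h := hG.2.unique hC ⟨v, c.mapLe hle, hc.mapLe hle, rfl⟩
    obtain ⟨σ, _, hσ, _⟩ := hC.exists_successor
    have h1 := hσ y hy
    rw [h, Walk.adj_toSubgraph_mapLe] at h1
    exact (deleteIncidenceSet_adj.1 h1.adj_sub).2.1 rfl
  have c : (G.deleteIncidenceSet y).Coloring Bool := hacyc.colorable_two.toColoring (by simp)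
  exact ⟨c, fun u hu v hv huv => c.valid (deleteIncidenceSet_adj.2 ⟨huv, hu, hv⟩)⟩

/-- The vertex `x` outside `C` is attached to the vertex `y` of `C`. -/
structure Subgraph.IsAttachment (C : G.Subgraph) (x y : V) : Prop where
  notMem : x ∉ C.verts
  mem : y ∈ C.verts
  adj : G.Adj x y

lemma Subgraph.mem_firstNeighborhood {x : V} :
    x ∈ C.firstNeighborhood ↔ ∃ y, C.IsAttachment x y := by
  constructor
  · rintro ⟨hx, y, hxy, hy⟩
    exact ⟨y, hx, hy, hxy⟩
  · rintro ⟨y, hx, hy, hxy⟩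
    exact ⟨hx, y, hxy, hy⟩

variable (G) in
/-- The vertex set of the branch at `x`, once the edge `xy` is removed. -/
def branchVerts (x y : V) : Set V := (G.branchComponent x y).supp

lemma mem_branchVerts {x y v : V} :
    v ∈ G.branchVerts x y ↔ (G.deleteEdges {s(x, y)}).Reachable v x :=
  ConnectedComponent.eq

lemma self_mem_branchVerts {x y : V} : x ∈ G.branchVerts x y :=
  mem_branchVerts.2 (Reachable.refl x)

lemma Reachable.mem_of_closed {s : Set V} (hs : ∀ u ∈ s, ∀ v, G.Adj u v → v ∈ s) {u v : V}
    (h : G.Reachable u v) (hu : u ∈ s) : v ∈ s := by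
  obtain ⟨p⟩ := h
  induction p with
  | nil => exact hu
  | cons hadj _ ih => exact ih (hs _ hu _ hadj)

namespace Subgraph.IsAttachment

variable {x y x' y' : V}

/-- Otherwise `x` would reach `y` through `C` without the bridge `xy`. -/
lemma notMem_cycle_of_mem_branchVerts (h : C.IsAttachment x y) (hG : G.IsUnicyclic)
    (hC : C.IsCycleOf) {v : V} (hv : v ∈ G.branchVerts x y) : v ∉ C.verts := by
  intro hvC
  have he : s(x, y) ∉ C.edgeSet := fun he => h.notMem (C.edge_vert he)
  exact isBridge_iff.1 (hG.isBridge hC (e := s(x, y)) h.adj he)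
    ((mem_branchVerts.1 hv).symm.trans (hC.connected.reachable_deleteEdges he hvC h.mem))

lemma eq_of_adj_of_notMem (h : C.IsAttachment x y) (hG : G.IsUnicyclic) (hC : C.IsCycleOf)
    {u v : V} (hu : u ∈ G.branchVerts x y) (hv : v ∉ G.branchVerts x y) (huv : G.Adj u v) :
    u = x ∧ v = y := by
  by_cases he : s(u, v) = s(x, y)
  · rcases Sym2.eq_iff.1 he with h' | ⟨rfl, rfl⟩
    · exact h'
    · exact absurd h.mem (h.notMem_cycle_of_mem_branchVerts hG hC hu)
  · have h1 : (G.deleteEdges {s(x, y)}).Adj u v := by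
      rw [SimpleGraph.deleteEdges_adj]
      exact ⟨huv, he⟩
    exact absurd (mem_branchVerts.2 (h1.symm.reachable.trans (mem_branchVerts.1 hu))) hv

/-- Different branches are disjoint. -/
lemma eq_of_mem_branchVerts (h : C.IsAttachment x y) (h' : C.IsAttachment x' y')
    (hG : G.IsUnicyclic) (hC : C.IsCycleOf) {v : V} (hv : v ∈ G.branchVerts x y)
    (hv' : v ∈ G.branchVerts x' y') : x = x' ∧ y = y' := by
  -- Inside the first branch no edge leaves the second, since the only exit leads to `y'` on the
  -- cycle; so the intersection is closed and contains `x`. The edge `xy` then leaves the second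
  -- branch, which identifies it with `x'y'`.
  have h1 : x ∈ G.branchVerts x y ∩ G.branchVerts x' y' := by
    refine Reachable.mem_of_closed ?_ (mem_branchVerts.1 hv) ⟨hv, hv'⟩
    rintro a ⟨ha, ha'⟩ b hab
    have hb : b ∈ G.branchVerts x y :=
      mem_branchVerts.2 (hab.symm.reachable.trans (mem_branchVerts.1 ha))
    refine ⟨hb, ?_⟩
    by_contra hb'
    have h2 := h'.eq_of_adj_of_notMem hG hC ha' hb' (SimpleGraph.deleteEdges_le _ hab)
    exact h.notMem_cycle_of_mem_branchVerts hG hC hb (h2.2 ▸ h'.mem)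
  exact h'.eq_of_adj_of_notMem hG hC h1.2
    (fun hy => h'.notMem_cycle_of_mem_branchVerts hG hC hy h.mem) h.adj

end Subgraph.IsAttachment

lemma IsUnicyclic.exists_mem_branchVerts (hG : G.IsUnicyclic) (hC : C.IsCycleOf) {v : V}
    (hv : v ∉ C.verts) : ∃ x y, C.IsAttachment x y ∧ v ∈ G.branchVerts x y := by
  obtain ⟨u, hu⟩ := hC.connected.nonempty
  have h : v ∈ {v | v ∈ C.verts ∨ ∃ x y, C.IsAttachment x y ∧ v ∈ G.branchVerts x y} := by
    refine Reachable.mem_of_closed ?_ (hG.1.preconnected u v) (Or.inl hu)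
    rintro a ha b hab
    by_cases hb : b ∈ C.verts
    · exact Or.inl hb
    rcases ha with ha | ⟨x, y, hxy, ha⟩
    · exact Or.inr ⟨b, a, ⟨hb, ha, hab.symm⟩, self_mem_branchVerts⟩
    · refine Or.inr ⟨x, y, hxy, ?_⟩
      by_contra hb'
      exact hb ((hxy.eq_of_adj_of_notMem hG hC ha hb' hab).2 ▸ hxy.mem)
  exact h.resolve_left hv

/-- The inclusion of a branch as an induced subgraph. -/
def Subgraph.IsAttachment.branchEmbedding {x y : V} (h : C.IsAttachment x y) (hG : G.IsUnicyclic)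
    (hC : C.IsCycleOf) : G.branch x y ↪g G where
  toFun := Subtype.val
  inj' := Subtype.val_injective
  map_rel_iff' := by
    rintro ⟨a, ha⟩ ⟨b, hb⟩
    change G.Adj a b ↔ (G.deleteEdges {s(x, y)}).Adj a b
    rw [SimpleGraph.deleteEdges_adj]
    refine ⟨fun hab => ⟨hab, fun he => ?_⟩, fun hab => hab.1⟩
    rcases Sym2.eq_iff.1 he with ⟨_, rfl⟩ | ⟨rfl, _⟩
    · exact h.notMem_cycle_of_mem_branchVerts hG hC hb h.mem
    · exact h.notMem_cycle_of_mem_branchVerts hG hC ha h.mem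

lemma Subgraph.IsAttachment.range_branchEmbedding {x y : V} (h : C.IsAttachment x y)
    (hG : G.IsUnicyclic) (hC : C.IsCycleOf) :
    Set.range (h.branchEmbedding hG hC) = G.branchVerts x y :=
  Subtype.range_coe_subtype

end Structure

/-! ### Comparing the core and the kernel with the forest off the cycle -/

section Main

variable {V : Type*} [Finite V] {G : SimpleGraph V} {C : G.Subgraph}

/-- In a unicyclic graph that is not König–Egerváry, the root of a branch is avoided by some
maximum independent set of the branch. -/
lemma Subgraph.IsAttachment.notMem_coreOn {x y : V} (h : C.IsAttachment x y)
    (hG : G.IsUnicyclic) (hC : C.IsCycleOf) (hKE : ¬ G.IsKonigEgervary) :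
    x ∉ G.coreOn (G.branchVerts x y) := by
  classical
  have hTA : G.branchVerts x y ⊆ {y}ᶜ := by
    rintro v hv rfl
    exact h.notMem_cycle_of_mem_branchVerts hG hC hv h.mem
  rw [← mem_coreOn_iff_of_subset hTA
    (fun u hu v hv huv => hv.1 (h.eq_of_adj_of_notMem hG hC hu hv.2 huv).2) self_mem_branchVerts]
  intro hx
  obtain ⟨S, hS⟩ := G.exists_isMaxIndepOn {y}ᶜ
  obtain ⟨f, hf⟩ := hS.exists_matchesInto_sdiff_singleton
    (hG.isBipartiteOn_compl_singleton hC h.mem) hx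
  have hxS := hx.2 S hS
  have hmem : ∀ v ∈ Sᶜ, v ≠ y → v ∈ ({y}ᶜ : Set V) \ S := fun v hv hvy => ⟨hvy, hv⟩
  -- As `f` avoids `x`, the remaining vertex `y` can be matched to `x`.
  refine hKE (MatchesInto.isKonigEgervary (S := S) (f := Function.update f y x) ⟨?_, ?_, ?_⟩
    hS.indep)
  · intro u hu v hv huv
    by_cases huy : u = y <;> by_cases hvy : v = y
    · rw [huy, hvy]
    · rw [huy, Function.update_self, Function.update_of_ne hvy] at huv
      exact absurd huv.symm (hf.mapsTo (hmem v hv hvy)).2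
    · rw [hvy, Function.update_self, Function.update_of_ne huy] at huv
      exact absurd huv (hf.mapsTo (hmem u hu huy)).2
    · rw [Function.update_of_ne hvy, Function.update_of_ne huy] at huv
      exact hf.injOn (hmem u hu huy) (hmem v hv hvy) huv
  · intro v hv
    by_cases hvy : v = y
    · rw [hvy, Function.update_self]
      exact hxS
    · rw [Function.update_of_ne hvy]
      exact (hf.mapsTo (hmem v hv hvy)).1
  · intro v hv
    by_cases hvy : v = y
    · rw [hvy, Function.update_self]
      exact h.adj.symm
    · rw [Function.update_of_ne hvy]
      exact hf.adj v (hmem v hv hvy)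

omit [Finite V] in
lemma Subgraph.IsAttachment.branchVerts_subset {x y : V} (h : C.IsAttachment x y)
    (hG : G.IsUnicyclic) (hC : C.IsCycleOf) : G.branchVerts x y ⊆ C.vertsᶜ :=
  fun _ hv => h.notMem_cycle_of_mem_branchVerts hG hC hv

omit [Finite V] in
lemma Subgraph.IsAttachment.not_adj {x y : V} (h : C.IsAttachment x y)
    (hG : G.IsUnicyclic) (hC : C.IsCycleOf) :
    ∀ u ∈ G.branchVerts x y, ∀ v ∈ C.vertsᶜ \ G.branchVerts x y, ¬ G.Adj u v :=
  fun _ hu _ hv huv => hv.1 ((h.eq_of_adj_of_notMem hG hC hu hv.2 huv).2 ▸ h.mem)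

omit [Finite V] in
lemma IsUnicyclic.isBipartiteOn_compl (hG : G.IsUnicyclic) (hC : C.IsCycleOf) :
    G.IsBipartiteOn C.vertsᶜ := by
  obtain ⟨u, hu⟩ := hC.connected.nonempty
  refine (hG.isBipartiteOn_compl_singleton hC hu).mono ?_
  rintro v hv rfl
  exact hv hu

/-- Some maximum independent set off the cycle has no neighbour on the cycle. -/
lemma IsUnicyclic.exists_isMaxIndepOn_disjoint (hG : G.IsUnicyclic) (hC : C.IsCycleOf)
    (hKE : ¬ G.IsKonigEgervary) :
    ∃ S, G.IsMaxIndepOn C.vertsᶜ S ∧ Disjoint S C.firstNeighborhood := by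
  obtain ⟨S, hS, hmin⟩ := Set.exists_min_image {S | G.IsMaxIndepOn C.vertsᶜ S}
    (fun S => (S ∩ C.firstNeighborhood).ncard) (Set.toFinite _) (G.exists_isMaxIndepOn _)
  refine ⟨S, hS, Set.disjoint_left.2 fun x hxS hx => ?_⟩
  obtain ⟨y, hxy⟩ := Subgraph.mem_firstNeighborhood.1 hx
  have hW : ∃ W, G.IsMaxIndepOn (G.branchVerts x y) W ∧ x ∉ W := by
    by_contra! h
    exact hxy.notMem_coreOn hG hC hKE ⟨self_mem_branchVerts, h⟩
  obtain ⟨W, hW, hxW⟩ := hW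
  -- A branch meets `C.firstNeighborhood` only in its root, so exchanging within it for a set
  -- avoiding `x` loses `x` and gains nothing.
  have h1 := hmin _ (hS.exchange (hxy.branchVerts_subset hG hC) (hxy.not_adj hG hC) hW)
  refine absurd (Set.ncard_lt_ncard (?_ : (W ∪ (S \ G.branchVerts x y)) ∩ C.firstNeighborhood ⊂
    S ∩ C.firstNeighborhood)) (not_lt.2 h1)
  refine Set.ssubset_iff_exists.2 ⟨?_, x, ⟨hxS, hx⟩, ?_⟩
  · rintro u ⟨hu | hu, huN⟩
    · obtain ⟨y', huy⟩ := Subgraph.mem_firstNeighborhood.1 huN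
      have := (hxy.eq_of_mem_branchVerts huy hG hC (hW.subset hu) self_mem_branchVerts).1
      exact absurd hu (this ▸ hxW)
    · exact ⟨hu.1, huN⟩
  · rintro ⟨hu | hu, _⟩
    · exact hxW hu
    · exact hu.2 self_mem_branchVerts

/-- A vertex off the cycle and outside the core is avoided by a maximum independent set off the
cycle with at most one neighbour on the cycle. -/
lemma IsUnicyclic.exists_isMaxIndepOn_notMem (hG : G.IsUnicyclic) (hC : C.IsCycleOf)
    (hKE : ¬ G.IsKonigEgervary) {v : V} (hv : v ∉ C.verts) (hv' : v ∉ G.coreOn C.vertsᶜ) :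
    ∃ S, G.IsMaxIndepOn C.vertsᶜ S ∧ v ∉ S ∧
      ∃ y ∈ C.verts, ∀ u ∈ S, ∀ w ∈ C.verts, G.Adj u w → w = y := by
  obtain ⟨x, y, hxy, hvT⟩ := hG.exists_mem_branchVerts hC hv
  rw [mem_coreOn_iff_of_subset (hxy.branchVerts_subset hG hC) (hxy.not_adj hG hC) hvT] at hv'
  have hW : ∃ W, G.IsMaxIndepOn (G.branchVerts x y) W ∧ v ∉ W := by
    by_contra! h
    exact hv' ⟨hvT, h⟩
  obtain ⟨W, hW, hvW⟩ := hW
  obtain ⟨S, hS, hSN⟩ := hG.exists_isMaxIndepOn_disjoint hC hKE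
  -- Only the branch containing `v` is changed, so contact with the cycle can occur only at `y`.
  refine ⟨_, hS.exchange (hxy.branchVerts_subset hG hC) (hxy.not_adj hG hC) hW, ?_, y, hxy.mem, ?_⟩
  · rintro (h | h)
    · exact hvW h
    · exact h.2 hvT
  · rintro u (hu | hu) w hw huw
    · exact (hxy.eq_of_adj_of_notMem hG hC (hW.subset hu)
        (fun h => hxy.notMem_cycle_of_mem_branchVerts hG hC h hw) huw).2
    · exact absurd (Subgraph.mem_firstNeighborhood.2 ⟨w, hS.subset hu.1, hw, huw⟩)
        (Set.disjoint_left.1 hSN hu.1)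

/-- Every vertex of the cycle is avoided by a maximum independent set of the cycle. -/
lemma IsUnicyclic.exists_isMaxIndepOn_cycle (hG : G.IsUnicyclic) (hC : C.IsCycleOf) (y : V) :
    ∃ J, G.IsMaxIndepOn C.verts J ∧ y ∉ J := by
  obtain ⟨σ, hinj, hadj, hσ⟩ := hC.exists_successor
  obtain ⟨J, hJ⟩ := G.exists_isMaxIndepOn C.verts
  by_cases hy : y ∈ J
  swap
  · exact ⟨J, hJ, hy⟩
  have hsub : σ '' J ⊆ C.verts := by
    rintro _ ⟨v, hv, rfl⟩
    exact (hadj v (hJ.subset hv)).snd_mem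
  -- Rotate `J` by one step: the predecessor of `y ∈ J` is not in `J`, and independence survives
  -- because the cycle has no chord.
  refine ⟨σ '' J, hJ.of_ncard_le hsub ?_ ?_, ?_⟩
  · rw [isIndepSet_iff_forall_not_adj]
    rintro _ ⟨u, hu, rfl⟩ _ ⟨v, hv, rfl⟩ huv
    have hu' := hsub ⟨u, hu, rfl⟩
    have hv' := hsub ⟨v, hv, rfl⟩
    rcases hσ _ _ (hG.adj_cycle hC hu' hv' huv) with h | h
    · have := hinj (hJ.subset hv) hu' h
      exact hJ.indep.not_adj hu hv (this ▸ (hadj u (hJ.subset hu)).adj_sub)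
    · have := hinj (hJ.subset hu) hv' h
      exact hJ.indep.not_adj hv hu (this ▸ (hadj v (hJ.subset hv)).adj_sub)
  · rw [Set.InjOn.ncard_image (hinj.mono hJ.subset)]
  · rintro ⟨z, hz, rfl⟩
    exact hJ.indep.not_adj hz hy (hadj z (hJ.subset hz)).adj_sub

/-- The core of the graph is the core of the forest obtained by deleting the cycle. -/
theorem IsUnicyclic.core_eq (hG : G.IsUnicyclic) (hC : C.IsCycleOf)
    (hKE : ¬ G.IsKonigEgervary) : G.core = G.coreOn C.vertsᶜ := by
  rw [← coreOn_univ]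
  obtain ⟨S, hS, hSN⟩ := hG.exists_isMaxIndepOn_disjoint hC hKE
  have hSC : ∀ u ∈ S, ∀ w ∈ C.verts, ¬ G.Adj u w := fun u hu w hw huw =>
    Set.disjoint_left.1 hSN hu (Subgraph.mem_firstNeighborhood.2 ⟨w, hS.subset hu, hw, huw⟩)
  ext v
  constructor
  · rintro ⟨_, hv⟩
    by_cases hvC : v ∈ C.verts
    · obtain ⟨J, hJ, hvJ⟩ := hG.exists_isMaxIndepOn_cycle hC v
      rcases hv _ (hS.union_compl hJ fun u hu w hw => hSC u hu w (hJ.subset hw)) with h | h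
      · exact absurd hvC (hS.subset h)
      · exact absurd h hvJ
    · by_contra hv'
      obtain ⟨S', hS', hvS', y, hy, hSy⟩ := hG.exists_isMaxIndepOn_notMem hC hKE hvC hv'
      obtain ⟨J, hJ, hyJ⟩ := hG.exists_isMaxIndepOn_cycle hC y
      rcases hv _ (hS'.union_compl hJ fun u hu w hw huw =>
        hyJ (hSy u hu w (hJ.subset hw) huw ▸ hw)) with h | h
      · exact hvS' h
      · exact hvC (hJ.subset h)
  · intro hv
    refine ⟨Set.mem_univ v, fun I hI => ?_⟩
    obtain ⟨J, hJ⟩ := G.exists_isMaxIndepOn C.verts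
    exact (hv.2 _ (hS.sdiff_of_union_compl hJ
      (fun u hu w hw => hSC u hu w (hJ.subset hw)) hI)).1

/-- Vertices on a cycle do not increase the difference. -/
lemma Subgraph.IsCycleOf.diffOn_univ_le (hC : C.IsCycleOf) (I : Set V) :
    G.diffOn Set.univ I ≤ G.diffOn C.vertsᶜ (I \ C.verts) := by
  obtain ⟨σ, hinj, hadj, _⟩ := hC.exists_successor
  have h1 := Set.ncard_inter_add_ncard_sdiff_eq_ncard I C.verts
  -- The successors of `I ∩ C.verts` are as many neighbours on the cycle, which cancel the
  -- contribution of that part.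
  have h2 : (G.setNeighborhood (I \ C.verts) ∩ C.vertsᶜ) ∪ σ '' (I ∩ C.verts) ⊆
      G.setNeighborhood I ∩ Set.univ := by
    rintro v (⟨hv, _⟩ | ⟨u, hu, rfl⟩)
    · obtain ⟨w, hw, hvw⟩ := mem_setNeighborhood.1 hv
      exact ⟨mem_setNeighborhood.2 ⟨w, hw.1, hvw⟩, trivial⟩
    · exact ⟨mem_setNeighborhood.2 ⟨u, hu.1, (hadj u hu.2).adj_sub.symm⟩, trivial⟩
  have h3 := Set.ncard_le_ncard h2
  rw [Set.ncard_union_eq, Set.InjOn.ncard_image (hinj.mono Set.inter_subset_right)] at h3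
  · simp only [diffOn]
    omega
  · refine Set.disjoint_left.2 ?_
    rintro _ hv ⟨u, hu, rfl⟩
    exact hv.2 (hadj u hu.2).snd_mem

lemma Subgraph.IsCycleOf.isCriticalOn_univ (hC : C.IsCycleOf) {S : Set V}
    (hS : G.IsCriticalOn C.vertsᶜ S) (hSC : ∀ u ∈ S, ∀ w ∈ C.verts, ¬ G.Adj u w) :
    G.diffOn Set.univ S = G.diffOn C.vertsᶜ S ∧ G.IsCriticalOn Set.univ S := by
  have h : G.setNeighborhood S ∩ Set.univ = G.setNeighborhood S ∩ C.vertsᶜ := by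
    ext v
    refine ⟨fun hv => ⟨hv.1, fun hvC => ?_⟩, fun hv => ⟨hv.1, trivial⟩⟩
    obtain ⟨u, hu, hvu⟩ := mem_setNeighborhood.1 hv.1
    exact hSC u hu v hvC hvu.symm
  have h1 : G.diffOn Set.univ S = G.diffOn C.vertsᶜ S := by rw [diffOn, diffOn, h]
  refine ⟨h1, Set.subset_univ S, hS.indep, fun I _ hI => ?_⟩
  rw [h1]
  exact (hC.diffOn_univ_le I).trans
    (hS.le _ (fun u hu => hu.2) (hI.subset Set.sdiff_subset))

/-- The kernel of the graph is the core of the forest obtained by deleting the cycle. -/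
theorem IsUnicyclic.ker_eq (hG : G.IsUnicyclic) (hC : C.IsCycleOf)
    (hKE : ¬ G.IsKonigEgervary) : G.ker = G.coreOn C.vertsᶜ := by
  have hbip := hG.isBipartiteOn_compl hC
  obtain ⟨S, hS, hSN⟩ := hG.exists_isMaxIndepOn_disjoint hC hKE
  have hSC : ∀ u ∈ S, ∀ w ∈ C.verts, ¬ G.Adj u w := fun u hu w hw huw =>
    Set.disjoint_left.1 hSN hu (Subgraph.mem_firstNeighborhood.2 ⟨w, hS.subset hu, hw, huw⟩)
  have hScrit := hS.isCriticalOn hbip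
  obtain ⟨hdiff, hScrit'⟩ := hC.isCriticalOn_univ hScrit hSC
  ext v
  rw [mem_ker_iff_univ]
  constructor
  · intro hv
    refine ⟨hS.subset (hv S hScrit'), fun S' hS' => ?_⟩
    -- `S' ∩ S` is critical off the cycle and inherits from `S` the absence of neighbours on it,
    -- hence is critical in `G`.
    exact (hv _ (hC.isCriticalOn_univ (hbip.isCriticalOn_inter (hS'.isCriticalOn hbip) hScrit)
      fun u hu => hSC u hu.2).2).1
  · intro hv I hI
    have hI' : G.IsCriticalOn C.vertsᶜ (I \ C.verts) := by
      refine ⟨fun u hu => hu.2, hI.indep.subset Set.sdiff_subset, fun K hK hK' => ?_⟩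
      have h1 := hScrit.le K hK hK'
      have h2 := hI.le S (Set.subset_univ S) hS.indep
      have h3 := hC.diffOn_univ_le (G := G) I
      omega
    exact ((hbip.mem_coreOn_iff.1 hv).2 _ hI').1

/-- The union of the kernels of the branches is the core of the forest obtained by deleting the
cycle. -/
theorem IsUnicyclic.unionKerBranches_eq (hG : G.IsUnicyclic) (hC : C.IsCycleOf) :
    G.unionKerBranches C = G.coreOn C.vertsᶜ := by
  have hbip := hG.isBipartiteOn_compl hC
  have key : ∀ {x y v : V} (_ : C.IsAttachment x y),
      v ∈ Subtype.val '' (G.branch x y).ker ↔ v ∈ G.branchVerts x y ∧ v ∈ G.coreOn C.vertsᶜ := by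
    intro x y v h
    have hsub := h.branchVerts_subset hG hC
    have h1 := mem_image_ker_iff (h.branchEmbedding hG hC) (v := v)
    rw [h.range_branchEmbedding hG hC, ← (hbip.mono hsub).mem_coreOn_iff] at h1
    refine h1.trans ⟨fun hv => ⟨hv.1, ?_⟩, fun hv => ?_⟩
    · exact (mem_coreOn_iff_of_subset hsub (h.not_adj hG hC) hv.1).2 hv
    · exact (mem_coreOn_iff_of_subset hsub (h.not_adj hG hC) hv.1).1 hv.2
  ext v
  simp only [unionKerBranches, Set.mem_iUnion]
  constructor
  · rintro ⟨x, hx, y, hy, hv⟩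
    exact ((key ⟨hx.1, hy.1, hy.2⟩).1 hv).2
  · intro hv
    obtain ⟨x, y, hxy, hvT⟩ := hG.exists_mem_branchVerts hC hv.1
    exact ⟨x, Subgraph.mem_firstNeighborhood.2 ⟨y, hxy⟩, y, ⟨hxy.mem, hxy.adj⟩,
      (key hxy).2 ⟨hvT, hv⟩⟩

end Main

end SimpleGraph

theorem mainTheorem1 {V : Type*} [Finite V] (G : SimpleGraph V) (hG : G.IsUnicyclic)
    (hKE : ¬ G.IsKonigEgervary) (C : G.Subgraph) (hC : C.IsCycleOf) :
    G.ker = G.unionKerBranches C ∧ G.unionKerBranches C = G.core := by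
  rw [hG.unionKerBranches_eq hC, hG.ker_eq hC hKE, hG.core_eq hC hKE]
  exact ⟨rfl, rfl⟩
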